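/- For integers $n,k,m\ge 0$ let $w_{n,k,m}$ be the number of Dyck paths of semilength $n$ (words with $n$ letters $U$ and $n$ letters $D$ in which every prefix contains at least as many $U$'s as $D$'s) having exactly $k$ occurrences of $UD$ and exactly $m$ occurrences of $UUD$ as factors, that is, as blocks of consecutive letters. Let $$W_{n,k}(t)=\sum_{m=0}^{k} w_{n,k,m}\,t^m .$$ A polynomial with real coefficients is called real-rooted if all of its complex roots are real; constant polynomials, including the zero polynomial, are also called real-rooted. Theorem. For all integers $n,k\ge 0$ the polynomial $W_{n,k}(t)$ is real-rooted. Moreover, the sequence $w_{n,k,0},w_{n,k,1},\dots,w_{n,k,k}$ of its coefficients is unimodal: there is $j$ with $0\le j\le k$ such that $$w_{n,k,0}\le w_{n,k,1}\le\cdots\le w_{n,k,j}\ge w_{n,k,j+1}\ge\cdots\ge w_{n,k,k}.$$ -/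

import Mathlib

namespace DyckPaths

open Polynomial

/-- The number of occurrences of the nonempty word `F` as a factor (a block of consecutive letters)
of `l`, i.e. the number of positions of `l` at which `F` can be read off. -/
def factorCount (F l : List DyckStep) : ℕ :=
  l.tails.countP (fun s => F.isPrefixOf s)

/-- `w n k m` is the number of Dyck paths of semilength `n` with exactly `k` occurrences of the
factor `UD` and exactly `m` occurrences of the factor `UUD`. -/
def w (n k m : ℕ) : ℕ :=
  (Finset.univ.filter (fun p : {p : DyckWord // p.semilength = n} =>
    factorCount [DyckStep.U, DyckStep.D] p.1.toList = k ∧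
    factorCount [DyckStep.U, DyckStep.U, DyckStep.D] p.1.toList = m)).card

/-- `W n k` is the real polynomial `∑_{m = 0}^{k} w n k m * t ^ m`. -/
noncomputable def W (n k : ℕ) : ℝ[X] :=
  ∑ m ∈ Finset.range (k + 1), C (w n k m : ℝ) * X ^ m

/-- A real polynomial is real-rooted if all its complex roots are real; constant polynomials
(including the zero polynomial) are real-rooted by convention. -/
def RealRooted (p : ℝ[X]) : Prop :=
  (∃ c : ℝ, p = C c) ∨ ∀ z : ℂ, aeval z p = 0 → ∃ x : ℝ, z = (x : ℂ)

/-- The finite sequence `a 0, …, a k` is unimodal: for some `0 ≤ j ≤ k`,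
`a 0 ≤ a 1 ≤ ⋯ ≤ a j ≥ a (j + 1) ≥ ⋯ ≥ a k`. -/
def UnimodalUpTo (k : ℕ) (a : ℕ → ℝ) : Prop :=
  ∃ j ≤ k, (∀ m, m < j → a m ≤ a (m + 1)) ∧ (∀ m, j ≤ m → m < k → a (m + 1) ≤ a m)

end DyckPaths

/-! Cut a Dyck path after each `D` into blocks U^a D. A block contributes one UD iff a ≥ 1 and one
UUD iff a ≥ 2, so the weight y^#UD t^#UUD is multiplicative, with block series φ = 1 + yx(1 +
tx/(1-x)). The first-passage form of Lagrange inversion (`lagrange_recurrence`) says that n+1 times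
the total weight is [x^n] φ^(n+1). Expanding (`succ_mul_w`) gives, for 0 < k < n, the polynomial
C(n+1,k)/(n+1) · ∑ C(k,m) C(n-k-1,m-1) t^m over m ≥ 1; for other k it is constant. After division by
t, the substitution t = (x+1)/x turns this sum, up to elementary factors, into the (k-1)-th
derivative of (x+1)^k x^(n-k-1), which is real-rooted by Rolle. Unimodality is read off directly
from the ratios of consecutive coefficients. -/

namespace DyckPaths

/-! ### Block decomposition of Dyck paths -/

open DyckStep

/-- The word `l` is read as a path starting at height `h`, staying nonnegative, ending at `0`. -/
def DescendsFrom : ℕ → List DyckStep → Prop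
  | h, [] => h = 0
  | h, U :: l => DescendsFrom (h + 1) l
  | 0, D :: _ => False
  | h + 1, D :: l => DescendsFrom h l

theorem descendsFrom_iff (h : ℕ) (l : List DyckStep) :
    DescendsFrom h l ↔ h + l.count U = l.count D ∧
      ∀ i, (l.take i).count D ≤ h + (l.take i).count U := by
  induction l generalizing h with
  | nil => simp [DescendsFrom]
  | cons x l ih =>
    cases x with
    | U =>
      rw [DescendsFrom, ih]
      refine and_congr (by simp; omega) ⟨fun H i => ?_, fun H i => ?_⟩
      · cases i with
        | zero => simp
        | succ i => have := H i; simp; omega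
      · have := H (i + 1); simp at this; omega
    | D =>
      cases h with
      | zero =>
        simp only [DescendsFrom, false_iff, not_and, not_forall]
        intro _
        exact ⟨1, by simp⟩
      | succ h =>
        rw [DescendsFrom, ih]
        refine and_congr (by simp; omega) ⟨fun H i => ?_, fun H i => ?_⟩
        · cases i with
          | zero => simp
          | succ i => have := H i; simp; omega
        · have := H (i + 1); simp at this; omega

theorem descendsFrom_replicate_append (a h : ℕ) (l : List DyckStep) :
    DescendsFrom h (List.replicate a U ++ l) ↔ DescendsFrom (h + a) l := by
  induction a generalizing h with
  | zero => simp
  | succ a ih =>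
    rw [List.replicate_succ, List.cons_append, DescendsFrom, ih]
    ring_nf

theorem DescendsFrom.exists_eq {h : ℕ} {l : List DyckStep} (H : DescendsFrom h l) (hl : l ≠ []) :
    ∃ a g l', l = List.replicate a U ++ D :: l' ∧ h + a = g + 1 ∧ DescendsFrom g l' := by
  induction l generalizing h with
  | nil => exact absurd rfl hl
  | cons x l ih =>
    cases x with
    | U =>
      rw [DescendsFrom] at H
      obtain ⟨a, g, l', rfl, hg, H'⟩ := ih H (by rintro rfl; simp [DescendsFrom] at H)
      exact ⟨a + 1, g, l', by simp [List.replicate_succ], by omega, H'⟩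
    | D =>
      cases h with
      | zero => exact H.elim
      | succ h => exact ⟨0, h, l, by simp, rfl, H⟩

/-- The words with `L` letters `D` that descend from height `h`. -/
def descents : ℕ → ℕ → Finset (List DyckStep)
  | 0, h => if h = 0 then {[]} else ∅
  | L + 1, h => (Finset.range (L + 2)).biUnion fun a =>
      if h + a = 0 then ∅ else
        (descents L (h + a - 1)).image fun l => List.replicate a U ++ D :: l

theorem mem_descents {L h : ℕ} {l : List DyckStep} :
    l ∈ descents L h ↔ DescendsFrom h l ∧ l.count D = L := by
  induction L generalizing h l with
  | zero =>
    rw [descents]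
    constructor
    · split_ifs with h0
      · intro hl
        rw [Finset.mem_singleton] at hl
        subst hl h0
        simp [DescendsFrom]
      · simp
    · rintro ⟨H, hc⟩
      have hl : l = [] := by
        by_contra hl
        obtain ⟨a, g, l', rfl, -, -⟩ := H.exists_eq hl
        simp at hc
      subst hl
      simp only [DescendsFrom] at H
      simp [H]
  | succ L ih =>
    simp only [descents, Finset.mem_biUnion, Finset.mem_range]
    constructor
    · rintro ⟨a, -, hl⟩
      split_ifs at hl with h0
      · simp at hl
      · obtain ⟨l', hl', rfl⟩ := Finset.mem_image.1 hl
        obtain ⟨H, hc⟩ := ih.1 hl'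
        obtain ⟨g, hg⟩ := Nat.exists_eq_succ_of_ne_zero h0
        refine ⟨?_, by simp [List.count_append, List.count_replicate, hc]⟩
        rw [descendsFrom_replicate_append, hg, DescendsFrom]
        simpa [hg] using H
    · rintro ⟨H, hc⟩
      obtain ⟨a, g, l', rfl, hg, H'⟩ := H.exists_eq (by rintro rfl; simp at hc)
      have hc' : l'.count D = L := by simpa [List.count_append, List.count_replicate] using hc
      have := ((descendsFrom_iff _ _).1 H').1
      -- Here h + a = g + 1, and a descent from g has at least g letters `D`, so a ≤ L + 1.
      refine ⟨a, by omega, ?_⟩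
      rw [if_neg (by omega)]
      refine Finset.mem_image.2 ⟨l', ih.2 ⟨?_, hc'⟩, rfl⟩
      rwa [hg, Nat.add_sub_cancel]

theorem replicate_append_cons_inj {a b : ℕ} {l l' : List DyckStep}
    (h : List.replicate a U ++ D :: l = List.replicate b U ++ D :: l') : a = b ∧ l = l' := by
  induction a generalizing b with
  | zero => cases b <;> simp_all [List.replicate_succ]
  | succ a ih =>
    cases b with
    | zero => simp [List.replicate_succ] at h
    | succ b =>
      simp only [List.replicate_succ, List.cons_append, List.cons.injEq, true_and] at h
      simpa using ih h

theorem sum_descents_succ {R : Type*} [CommRing R] (f : List DyckStep → R) (φ : ℕ → R)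
    (hf : ∀ a l, f (List.replicate a U ++ D :: l) = φ a * f l) (L h : ℕ) :
    ∑ l ∈ descents (L + 1) h, f l = ∑ a ∈ Finset.range (L + 2),
      φ a * if h + a = 0 then 0 else ∑ l ∈ descents L (h + a - 1), f l := by
  rw [descents, Finset.sum_biUnion]
  · refine Finset.sum_congr rfl fun a _ => ?_
    split_ifs
    · simp
    · rw [Finset.sum_image fun l _ l' _ h => (replicate_append_cons_inj h).2, Finset.mul_sum]
      exact Finset.sum_congr rfl fun l _ => hf a l
  · intro a _ b _ hab
    refine Finset.disjoint_left.2 fun l hl hl' => hab ?_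
    dsimp only at hl hl'
    split_ifs at hl hl' <;> simp only [Finset.notMem_empty, Finset.mem_image] at hl hl'
    obtain ⟨x, -, rfl⟩ := hl
    obtain ⟨y, -, hy⟩ := hl'
    exact (replicate_append_cons_inj hy).1.symm

theorem sum_dyckWord {M : Type*} [AddCommMonoid M] (f : List DyckStep → M) (n : ℕ) :
    ∑ p : {p : DyckWord // p.semilength = n}, f p.1.toList = ∑ l ∈ descents n 0, f l := by
  refine Finset.sum_bij (fun p _ => p.1.toList) ?_ ?_ ?_ fun _ _ => rfl
  · rintro ⟨p, rfl⟩ -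
    rw [mem_descents, descendsFrom_iff]
    refine ⟨⟨by simpa using p.count_U_eq_count_D, fun i => ?_⟩, ?_⟩
    · simpa using p.count_D_le_count_U i
    · exact p.semilength_eq_count_D.symm
  · rintro p - q - h
    exact Subtype.ext (DyckWord.ext h)
  · intro l hl
    obtain ⟨H, hc⟩ := mem_descents.1 hl
    obtain ⟨h1, h2⟩ := (descendsFrom_iff _ _).1 H
    simp only [zero_add] at h1 h2
    exact ⟨⟨⟨l, h1, h2⟩, by rw [DyckWord.semilength_eq_count_D]; exact hc⟩,
      Finset.mem_univ _, rfl⟩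

theorem factorCount_cons (F l : List DyckStep) (x : DyckStep) :
    factorCount F (x :: l) = factorCount F l + if F.isPrefixOf (x :: l) then 1 else 0 := by
  simp [factorCount, List.countP_cons]

theorem factorCount_UD (a : ℕ) (l : List DyckStep) :
    factorCount [U, D] (List.replicate a U ++ D :: l) =
      (if a = 0 then 0 else 1) + factorCount [U, D] l := by
  induction a with
  | zero => simp [factorCount_cons, List.isPrefixOf]
  | succ a ih =>
    rw [List.replicate_succ, List.cons_append, factorCount_cons, ih]
    cases a with
    | zero => simp [List.isPrefixOf, add_comm]
    | succ a => simp [List.isPrefixOf, List.replicate_succ]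

theorem factorCount_UUD (a : ℕ) (l : List DyckStep) :
    factorCount [U, U, D] (List.replicate a U ++ D :: l) =
      (if a ≤ 1 then 0 else 1) + factorCount [U, U, D] l := by
  induction a with
  | zero => simp [factorCount_cons, List.isPrefixOf]
  | succ a ih =>
    rw [List.replicate_succ, List.cons_append, factorCount_cons, ih]
    rcases a with _ | _ | a
    · simp [List.isPrefixOf]
    · simp [List.isPrefixOf, add_comm]
    · simp [List.isPrefixOf, List.replicate_succ]

end DyckPaths

namespace DyckPaths

open DyckStep Finset

/-! ### Lagrange inversion by first passage -/

section Lagrange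

open PowerSeries

/-- The operator h + x d/dx multiplies the a-th coefficient by h + a, so the sum is a Cauchy
product. -/
theorem sum_coeff_mul_coeff_X_pow_mul {R : Type*} [CommRing R] (φ ψ : PowerSeries R) (K h : ℕ) :
    ∑ a ∈ range (K + 1), coeff a φ * (((h + a : ℕ) : R) * coeff K (X ^ (h + a) * ψ)) =
      coeff K (((h : PowerSeries R) * φ + X * derivative R φ) * (X ^ h * ψ)) := by
  rw [coeff_mul, Finset.Nat.sum_antidiagonal_eq_sum_range_succ_mk]
  refine Finset.sum_congr rfl fun a ha => ?_
  have ha' : a ≤ K := by simpa [Nat.lt_succ_iff] using ha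
  have h1 : coeff a ((h : PowerSeries R) * φ + X * derivative R φ) =
      ((h + a : ℕ) : R) * coeff a φ := by
    rw [map_add, ← map_natCast (C (R := R)) h, coeff_C_mul]
    cases a with
    | zero => simp
    | succ a => rw [coeff_succ_X_mul, coeff_derivative]; push_cast; ring
  have h2 : coeff (K - a) (X ^ h * ψ) = coeff K (X ^ (h + a) * ψ) := by
    conv_rhs => rw [← Nat.sub_add_cancel ha', pow_add, mul_comm (X ^ h), mul_assoc, coeff_X_pow_mul]
  dsimp only
  rw [h1, h2]
  ring

/-- Solution of the first-passage recurrence with step weights `coeff a φ`. -/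
theorem lagrange_recurrence {R : Type*} [CommRing R] [IsDomain R] [CharZero R]
    (φ : PowerSeries R) (hφ : coeff 0 φ = 1) (H : ℕ → ℕ → R)
    (h0 : ∀ h, H 0 h = if h = 0 then 1 else 0)
    (hs : ∀ L h, H (L + 1) h = ∑ a ∈ range (L + 2),
      coeff a φ * if h + a = 0 then 0 else H L (h + a - 1)) (L h : ℕ) :
    ((L + 1 : ℕ) : R) * H L h = ((h + 1 : ℕ) : R) * coeff L (X ^ h * φ ^ (L + 1)) := by
  induction L generalizing h with
  | zero =>
    rw [h0, coeff_X_pow_mul']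
    split_ifs with h1 h2 h2
    · simp [h1, ← hφ]
    · omega
    · omega
    · simp
  | succ L ih =>
    -- The induction hypothesis at height h + a - 1 supplies the factor h + a, which also absorbs
    -- the excluded case h + a = 0.
    have key : ((L + 1 : ℕ) : R) * H (L + 1) h =
        coeff (L + 1) (((h : PowerSeries R) * φ + X * derivative R φ) * (X ^ h * φ ^ (L + 1))) := by
      rw [← sum_coeff_mul_coeff_X_pow_mul, hs, Finset.mul_sum]
      refine Finset.sum_congr rfl fun a _ => ?_
      rcases Nat.eq_zero_or_eq_succ_pred (h + a) with h1 | h1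
      · rw [h1]; simp
      · rw [h1, if_neg (Nat.succ_ne_zero _), Nat.succ_sub_one, mul_left_comm, ih,
          Nat.succ_eq_add_one, pow_succ' X, mul_assoc X, coeff_succ_X_mul]
    -- At x^(L+1) the operator x d/dx acts as L + 1, so the right side becomes (L+1)(h+1) times the
    -- wanted coefficient.
    have hd : ((L + 2 : ℕ) : PowerSeries R) *
        (((h : PowerSeries R) * φ + X * derivative R φ) * (X ^ h * φ ^ (L + 1))) =
        ((h * (L + 1) : ℕ) : PowerSeries R) * (X ^ h * φ ^ (L + 2)) +
          X * derivative R (X ^ h * φ ^ (L + 2)) := by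
      have hX : X * derivative R (X ^ h : PowerSeries R) =
          (h : PowerSeries R) * X ^ h := by
        rw [derivative_pow, derivative_X]
        cases h with
        | zero => simp
        | succ h => rw [Nat.add_sub_cancel]; ring
      have : X * derivative R (X ^ h * φ ^ (L + 2)) =
          (X * derivative R (X ^ h : PowerSeries R)) * φ ^ (L + 2) +
            X ^ h * X * derivative R (φ ^ (L + 2)) := by
        rw [Derivation.leibniz]; simp only [smul_eq_mul]; ring
      rw [this, hX, derivative_pow, Nat.add_sub_cancel_right (n := L + 1) (m := 1)]
      push_cast; ring
    have hc := congrArg (coeff (L + 1)) hd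
    rw [← map_natCast (C (R := R)) (L + 2), ← map_natCast (C (R := R)) (h * (L + 1)), map_add,
      coeff_C_mul, coeff_C_mul, coeff_succ_X_mul, coeff_derivative, ← key] at hc
    have hL : ((L + 1 : ℕ) : R) ≠ 0 := Nat.cast_ne_zero.2 L.succ_ne_zero
    refine mul_left_cancel₀ hL ?_
    push_cast at hc ⊢
    linear_combination hc

end Lagrange

/-! ### Closed formula for the coefficients -/

section Coefficients

open Polynomial

/-- The weight `y ^ #UD * t ^ #UUD` of a word, in `ℝ[t][y]`. -/
noncomputable def weight (l : List DyckStep) : ℝ[X][X] :=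
  X ^ factorCount [U, D] l * C (X ^ factorCount [U, U, D] l)

theorem coeff_weight (l : List DyckStep) (k m : ℕ) :
    ((weight l).coeff k).coeff m =
      if factorCount [U, D] l = k ∧ factorCount [U, U, D] l = m then 1 else 0 := by
  rw [weight, coeff_mul_C, coeff_X_pow]
  split_ifs with h1 h2 h2
  · simp [coeff_X_pow, h2.2]
  · rw [one_mul, coeff_X_pow, if_neg (fun h => h2 ⟨h1.symm, h.symm⟩)]
  · exact absurd h2.1.symm h1
  · simp

/-- The weights of an ascent of length `a`. -/
noncomputable def ascentSeries : PowerSeries ℝ[X][X] :=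
  1 + PowerSeries.C X * (PowerSeries.X *
    (1 + PowerSeries.C (C X) * (PowerSeries.X * PowerSeries.mk 1)))

theorem weight_replicate_append (a : ℕ) (l : List DyckStep) :
    weight (List.replicate a U ++ D :: l) = PowerSeries.coeff a ascentSeries * weight l := by
  rw [weight, weight, factorCount_UD, factorCount_UUD, ascentSeries, map_add,
    PowerSeries.coeff_C_mul]
  rcases a with _ | _ | a
  · simp
  · rw [PowerSeries.coeff_succ_X_mul, map_add, PowerSeries.coeff_C_mul]
    simp [PowerSeries.coeff_one, pow_add, mul_assoc]
  · rw [PowerSeries.coeff_succ_X_mul, map_add, PowerSeries.coeff_C_mul,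
      PowerSeries.coeff_succ_X_mul]
    simp [PowerSeries.coeff_one, pow_add]
    ring

theorem w_eq_coeff (n k m : ℕ) :
    (w n k m : ℝ) = ((∑ l ∈ descents n 0, weight l).coeff k).coeff m := by
  rw [← sum_dyckWord, finsetSum_coeff, finsetSum_coeff]
  simp_rw [coeff_weight]
  rw [w, Finset.sum_boole]

theorem succ_mul_sum_descents (n : ℕ) :
    ((n + 1 : ℕ) : ℝ[X][X]) * ∑ l ∈ descents n 0, weight l =
      PowerSeries.coeff n (ascentSeries ^ (n + 1)) := by
  have := lagrange_recurrence ascentSeries (by simp [ascentSeries])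
    (fun L h => ∑ l ∈ descents L h, weight l) ?_
    (fun L h => sum_descents_succ weight _ weight_replicate_append L h) n 0
  · simpa using this
  · intro h
    simp only [descents]
    split_ifs
    · simp [weight, factorCount, List.isPrefixOf]
    · simp

/-- The coefficient of `x ^ n` in `x ^ (k + m) * (1 - x) ^ (-m)`, i.e. the number of compositions
of `n - k` into `m` positive parts. -/
def compositionCount (n k : ℕ) : ℕ → ℕ
  | 0 => if n = k then 1 else 0
  | d + 1 => if k < n then (n - k - 1).choose d else 0

theorem coeff_X_pow_mul_geom_pow {R : Type*} [CommRing R] (n k m : ℕ) :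
    PowerSeries.coeff n (PowerSeries.X ^ (k + m) * PowerSeries.mk 1 ^ m : PowerSeries R) =
      compositionCount n k m := by
  rw [PowerSeries.coeff_X_pow_mul']
  cases m with
  | zero =>
    rw [pow_zero, PowerSeries.coeff_one, compositionCount]
    split_ifs <;> first | omega | simp
  | succ d =>
    rw [PowerSeries.mk_one_pow_eq_mk_choose_add, PowerSeries.coeff_mk, compositionCount]
    split_ifs with h1 h2 h2
    · congr 2; omega
    · omega
    · rw [Nat.choose_eq_zero_of_lt (by omega), Nat.cast_zero]
    · simp

theorem coeff_ascentSeries_pow (n N : ℕ) :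
    PowerSeries.coeff n (ascentSeries ^ N) =
      ∑ i ∈ range (N + 1), ∑ j ∈ range (i + 1),
        X ^ i * C (X ^ j * C ((N.choose i * (i.choose j * compositionCount n i j) : ℕ) : ℝ)) := by
  rw [ascentSeries, add_comm, add_pow, map_sum]
  refine Finset.sum_congr rfl fun i _ => ?_
  rw [mul_pow, mul_pow, add_comm (1 : PowerSeries ℝ[X][X]), add_pow, one_pow, Finset.mul_sum,
    Finset.mul_sum, mul_one, Finset.sum_mul, map_sum]
  refine Finset.sum_congr rfl fun j _ => ?_
  have : PowerSeries.C X ^ i * (PowerSeries.X ^ i *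
      ((PowerSeries.C (C X) * (PowerSeries.X * PowerSeries.mk 1)) ^ j * 1 ^ (i - j) *
        ((i.choose j : ℕ) : PowerSeries ℝ[X][X]))) * ((N.choose i : ℕ) : PowerSeries ℝ[X][X]) =
      PowerSeries.C (X ^ i * C X ^ j * ((N.choose i * i.choose j : ℕ) : ℝ[X][X])) *
        (PowerSeries.X ^ (i + j) * PowerSeries.mk 1 ^ j) := by
    simp only [map_mul, map_pow, map_natCast, Nat.cast_mul, one_pow]
    ring
  rw [this, PowerSeries.coeff_C_mul, coeff_X_pow_mul_geom_pow]
  simp only [map_mul, map_pow, map_natCast, Nat.cast_mul]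
  ring

theorem succ_mul_w (n k m : ℕ) :
    ((n + 1 : ℕ) : ℝ) * w n k m =
      ((n + 1).choose k * (k.choose m * compositionCount n k m) : ℕ) := by
  have h := congrArg (fun p : ℝ[X][X] => (p.coeff k).coeff m) (succ_mul_sum_descents n)
  have hc : ∀ p : ℝ[X][X], (((((n + 1 : ℕ) : ℝ[X][X]) * p)).coeff k).coeff m =
      ((n + 1 : ℕ) : ℝ) * (p.coeff k).coeff m := by
    intro p
    rw [← nsmul_eq_mul, coeff_smul, coeff_smul, nsmul_eq_mul]
  rw [hc, ← w_eq_coeff] at h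
  rw [h, coeff_ascentSeries_pow, finsetSum_coeff, finsetSum_coeff]
  simp_rw [finsetSum_coeff, coeff_mul_C, coeff_X_pow, ite_mul, one_mul, zero_mul, apply_ite
    (fun p : ℝ[X] => p.coeff m), coeff_mul_C, coeff_X_pow, coeff_zero, ite_mul, one_mul, zero_mul]
  have inner : ∀ i, (∑ j ∈ range (i + 1), if k = i then if m = j then
      ((((n + 1).choose i * (i.choose j * compositionCount n i j) : ℕ)) : ℝ) else 0 else 0) =
      if k = i then (((n + 1).choose i * (i.choose m * compositionCount n i m) : ℕ) : ℝ) else 0 := by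
    intro i
    split_ifs
    · rw [Finset.sum_ite_eq]
      split_ifs with hm
      · rfl
      · rw [(Nat.choose_eq_zero_of_lt (by simpa using hm) : i.choose m = 0)]; simp
    · simp
  simp_rw [inner]
  rw [Finset.sum_ite_eq]
  split_ifs with hk
  · rfl
  · rw [Nat.choose_eq_zero_of_lt (by simpa using hk)]; simp

end Coefficients

end DyckPaths

namespace DyckPaths

open Finset

/-! ### Real zeros via Rolle -/

section RealRooted

open Polynomial

/-- By Rolle, differentiation loses at most one real root counted with multiplicity, while the
degree of a nonconstant polynomial drops. -/
theorem splits_derivative {p : ℝ[X]} (hp : p.Splits) : (derivative p).Splits := by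
  rw [splits_iff_card_roots] at hp ⊢
  have h1 := card_roots_le_derivative p
  have h2 := (derivative p).card_roots'
  have h3 := natDegree_derivative_le p
  rcases Nat.eq_zero_or_pos p.natDegree with h0 | h0
  · rw [natDegree_eq_zero] at h0
    obtain ⟨c, rfl⟩ := h0
    simp
  · omega

theorem splits_iterate_derivative {p : ℝ[X]} (hp : p.Splits) (r : ℕ) :
    (derivative^[r] p).Splits := by
  induction r with
  | zero => exact hp
  | succ r ih => rw [Function.iterate_succ_apply']; exact splits_derivative ih

/-- Leibniz rule. The exponent k + 1, one more than the order of differentiation, produces the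
shifted binomial C(k+1, i+1). -/
theorem iterate_derivative_X_pow_mul_X_add_one_pow (N k : ℕ) :
    derivative^[k] ((X + 1) ^ (k + 1) * X ^ N : ℝ[X]) =
      ∑ i ∈ range (k + 1), C ((k.factorial * (N.choose i * (k + 1).choose (k - i)) : ℕ) : ℝ) *
        ((X + 1) ^ (i + 1) * X ^ (N - i)) := by
  rw [iterate_derivative_mul]
  refine Finset.sum_congr rfl fun i hi => ?_
  have hi' : i ≤ k := by simpa [Nat.lt_succ_iff] using hi
  have h1 := iterate_derivative_X_add_pow (R := ℝ) (k + 1) (k - i) 1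
  rw [map_one, show k + 1 - (k - i) = i + 1 by omega] at h1
  rw [h1, iterate_derivative_X_pow_eq_natCast_mul, Nat.descFactorial_eq_factorial_mul_choose,
    Nat.descFactorial_eq_factorial_mul_choose, ← Nat.choose_mul_factorial_mul_factorial hi']
  simp only [nsmul_eq_mul, Nat.cast_mul, map_mul, map_natCast]
  ring

theorem aeval_sum_choose_mul_choose (N k : ℕ) (x : ℂ) (hx : x ≠ 0) :
    aeval x (derivative^[k] ((X + 1) ^ (k + 1) * X ^ N : ℝ[X])) =
      k.factorial * x ^ N * ((x + 1) * aeval ((x + 1) / x)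
        (∑ i ∈ range (k + 1), C ((N.choose i * (k + 1).choose (i + 1) : ℕ) : ℝ) * X ^ i)) := by
  rw [iterate_derivative_X_pow_mul_X_add_one_pow, map_sum, map_sum, Finset.mul_sum, Finset.mul_sum]
  refine Finset.sum_congr rfl fun i hi => ?_
  have hi' : i ≤ k := by simpa [Nat.lt_succ_iff] using hi
  have hc : (k + 1).choose (k - i) = (k + 1).choose (i + 1) := by
    rw [← Nat.choose_symm (by omega : i + 1 ≤ k + 1)]; congr 1; omega
  rw [hc]
  rcases le_or_gt i N with hN | hN
  · obtain ⟨M, rfl⟩ := Nat.exists_eq_add_of_le hN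
    simp only [map_mul, map_natCast, map_pow, map_add, map_one, aeval_X, Nat.add_sub_cancel_left,
      Nat.cast_mul, div_pow, pow_add]
    field_simp
  · simp [Nat.choose_eq_zero_of_lt hN]

/-- The zeros of `∑ C(N, i) C(k + 1, i + 1) t ^ i` are real. -/
theorem exists_real_of_aeval_sum_choose_mul_choose_eq_zero (N k : ℕ) {z : ℂ}
    (hz : aeval z (∑ i ∈ range (k + 1),
      C ((N.choose i * (k + 1).choose (i + 1) : ℕ) : ℝ) * X ^ i) = 0) : ∃ x : ℝ, z = x := by
  -- The map x ↦ (x+1)/x omits only the value 1, which is real anyway.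
  by_cases h1 : z = 1
  · exact ⟨1, by simp [h1]⟩
  have h1' : z - 1 ≠ 0 := sub_ne_zero.2 h1
  set x : ℂ := 1 / (z - 1) with hx
  have hx0 : x ≠ 0 := one_div_ne_zero h1'
  have hzx : (x + 1) / x = z := by rw [hx]; field_simp; ring
  set Q : ℝ[X] := derivative^[k] ((X + 1) ^ (k + 1) * X ^ N) with hQ
  have hroot : aeval x Q = 0 := by
    rw [hQ, aeval_sum_choose_mul_choose N k x hx0, hzx, hz, mul_zero, mul_zero]
  have hsplit : Q.Splits := splits_iterate_derivative
    (((Splits.X_add_C 1).pow _).mul (Splits.X.pow _)) k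
  -- At 1 all Leibniz terms are nonnegative and the term i = 0 is positive.
  have hQ0 : Q ≠ 0 := by
    intro h0
    have h2 : Q.eval 1 = 0 := by rw [h0, eval_zero]
    rw [hQ, iterate_derivative_X_pow_mul_X_add_one_pow, eval_finsetSum] at h2
    have h3 := (Finset.sum_eq_zero_iff_of_nonneg (fun i _ => by simp; positivity)).1 h2 0 (by simp)
    simp [Nat.factorial_ne_zero] at h3
    norm_cast at h3
  obtain ⟨r, hr⟩ := hsplit.mem_range_of_isRoot hQ0 (i := algebraMap ℝ ℂ) (x := x)
    (by rw [IsRoot, eval_map_algebraMap, hroot])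
  have hr' : (r : ℂ) = x := hr
  exact ⟨(r + 1) / r, by rw [← hzx, ← hr']; push_cast; rfl⟩

end RealRooted

/-! ### Unimodality and conclusion -/

theorem unimodal_choose_mul_choose (N k : ℕ) {c : ℝ} (hc : 0 ≤ c) (a : ℕ → ℝ) (h0 : a 0 = 0)
    (ha : ∀ d, a (d + 1) = c * ((k + 1).choose (d + 1) * N.choose d : ℕ)) :
    UnimodalUpTo (k + 1) a := by
  have hpos : ∀ m, 0 ≤ a m := by
    rintro (_ | d)
    · rw [h0]
    · rw [ha]; positivity
  have hrec : ∀ m, a (m + 1) * ((m * (m + 1) : ℕ) : ℝ) =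
      a m * (((N + 1 - m) * (k + 1 - m) : ℕ) : ℝ) := by
    rintro (_ | d)
    · simp [h0]
    · rw [ha, ha, mul_assoc, mul_assoc, ← Nat.cast_mul, ← Nat.cast_mul]
      have e1 := Nat.choose_succ_right_eq (k + 1) (d + 1)
      have e2 := Nat.choose_succ_right_eq N d
      rw [show N + 1 - (d + 1) = N - d by omega]
      congr 2
      calc _ = ((k + 1).choose (d + 1 + 1) * (d + 1 + 1)) * (N.choose (d + 1) * (d + 1)) := by ring
        _ = _ := by rw [e1, e2]; ring
  -- The peak is the first such m: the left side decreases and the right side increases, so the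
  -- inequality persists. It fails at m = 0, where `hrec` only says 0 = 0.
  have hex : ∃ m, (N + 1 - m) * (k + 1 - m) < m * (m + 1) := ⟨k + 1, by simp⟩
  refine ⟨Nat.find hex, Nat.find_min' hex (by simp), fun m hm => ?_, fun m hm _ => ?_⟩
  · have h := not_lt.1 (Nat.find_min hex hm)
    rcases Nat.eq_zero_or_pos m with rfl | hm0
    · rw [h0]; exact hpos _
    · have hp : (0 : ℝ) < ((m * (m + 1) : ℕ) : ℝ) := by positivity
      refine le_of_mul_le_mul_right ?_ hp
      rw [hrec]
      exact mul_le_mul_of_nonneg_left (Nat.cast_le.2 h) (hpos m)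
  · have h1 := Nat.find_spec hex
    have h : (N + 1 - m) * (k + 1 - m) < m * (m + 1) :=
      calc _ ≤ (N + 1 - Nat.find hex) * (k + 1 - Nat.find hex) := by gcongr
        _ < _ := h1
        _ ≤ _ := by gcongr
    have hp : (0 : ℝ) < ((m * (m + 1) : ℕ) : ℝ) := Nat.cast_pos.2 (by omega)
    refine le_of_mul_le_mul_right ?_ hp
    rw [hrec]
    exact mul_le_mul_of_nonneg_left (Nat.cast_le.2 h.le) (hpos m)

section

open Polynomial

theorem coeff_W (n k m : ℕ) : (W n k).coeff m =
    (((n + 1).choose k : ℕ) : ℝ) / ((n + 1 : ℕ) : ℝ) * (k.choose m * compositionCount n k m : ℕ) := by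
  have hn : ((n + 1 : ℕ) : ℝ) ≠ 0 := Nat.cast_ne_zero.2 n.succ_ne_zero
  have hw : (w n k m : ℝ) = (((n + 1).choose k : ℕ) : ℝ) / ((n + 1 : ℕ) : ℝ) *
      (k.choose m * compositionCount n k m : ℕ) := by
    rw [div_mul_eq_mul_div, eq_div_iff hn, mul_comm, succ_mul_w, Nat.cast_mul]
  rw [W, finsetSum_coeff]
  simp_rw [coeff_C_mul, coeff_X_pow, mul_ite, mul_one, mul_zero]
  rw [Finset.sum_ite_eq]
  split_ifs with hm
  · exact hw
  · rw [(Nat.choose_eq_zero_of_lt (by simpa using hm) : k.choose m = 0)]; simp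

theorem W_eq_C {n k : ℕ} (h : ∀ d, k.choose (d + 1) * compositionCount n k (d + 1) = 0) :
    W n k = C ((W n k).coeff 0) := by
  ext (_ | d)
  · simp
  · rw [coeff_W, h, coeff_C_succ]; simp

theorem W_eq_mul {n k : ℕ} (h : k + 1 < n) :
    W n (k + 1) = C ((((n + 1).choose (k + 1) : ℕ) : ℝ) / ((n + 1 : ℕ) : ℝ)) *
      (X * ∑ i ∈ range (k + 1),
        C (((n - (k + 1) - 1).choose i * (k + 1).choose (i + 1) : ℕ) : ℝ) * X ^ i) := by
  ext (_ | d)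
  · rw [coeff_W, coeff_C_mul, coeff_X_mul_zero, compositionCount, if_neg h.ne']; simp
  · rw [coeff_W, coeff_C_mul, coeff_X_mul, finsetSum_coeff, compositionCount, if_pos h]
    simp_rw [coeff_C_mul, coeff_X_pow, mul_ite, mul_one, mul_zero]
    rw [Finset.sum_ite_eq]
    split_ifs with hd
    · rw [mul_comm (Nat.choose _ d)]
    · rw [Nat.choose_eq_zero_of_lt (by simpa using hd : k + 1 < d + 1)]; simp

theorem realRooted_and_unimodal_C (k : ℕ) {p : ℝ[X]} {c : ℝ} (hc : 0 ≤ c) (hp : p = C c) :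
    RealRooted p ∧ UnimodalUpTo k (fun m => p.coeff m) := by
  refine ⟨Or.inl ⟨c, hp⟩, 0, Nat.zero_le k, fun m hm => absurd hm (Nat.not_lt_zero m),
    fun m _ _ => ?_⟩
  subst hp
  simp only [coeff_C_succ, coeff_C]
  split_ifs <;> simp [hc]

end

end DyckPaths

theorem mainTheorem6 (n k : ℕ) :
    DyckPaths.RealRooted (DyckPaths.W n k) ∧
      DyckPaths.UnimodalUpTo k (fun m => (DyckPaths.W n k).coeff m) := by
  have h0 : 0 ≤ (DyckPaths.W n k).coeff 0 := by rw [DyckPaths.coeff_W]; positivity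
  by_cases h : k ≠ 0 ∧ k < n
  · obtain ⟨hk, hn⟩ := h
    obtain ⟨k, rfl⟩ := Nat.exists_eq_succ_of_ne_zero hk
    refine ⟨Or.inr fun z hz => ?_, ?_⟩
    · rw [Nat.succ_eq_add_one, DyckPaths.W_eq_mul hn, map_mul, map_mul, Polynomial.aeval_C,
        Polynomial.aeval_X, mul_eq_zero, mul_eq_zero] at hz
      rcases hz with hz | hz | hz
      · rw [map_eq_zero, div_eq_zero_iff, Nat.cast_eq_zero, Nat.cast_eq_zero,
          Nat.choose_eq_zero_iff] at hz
        omega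
      · exact ⟨0, by simp [hz]⟩
      · exact DyckPaths.exists_real_of_aeval_sum_choose_mul_choose_eq_zero _ _ hz
    · refine DyckPaths.unimodal_choose_mul_choose (n - (k + 1) - 1) k
        (c := (((n + 1).choose (k + 1) : ℕ) : ℝ) / ((n + 1 : ℕ) : ℝ)) (by positivity) _ ?_
        fun d => ?_
      · rw [DyckPaths.coeff_W, DyckPaths.compositionCount, if_neg hn.ne']; simp
      · rw [Nat.succ_eq_add_one, DyckPaths.coeff_W, DyckPaths.compositionCount, if_pos hn]
  -- For k = 0 or k ≥ n no positive power of t survives.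
  · refine DyckPaths.realRooted_and_unimodal_C k h0 (DyckPaths.W_eq_C fun d => ?_)
    rw [DyckPaths.compositionCount]
    split_ifs with hn
    · rw [show k = 0 by tauto, Nat.choose_zero_succ, zero_mul]
    · rw [mul_zero]
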